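/- Theorem (optimistic policy iteration for acyclic stochastic shortest path problems). Consider a Markov decision process with finite state space $\{0,1,\dots,n\}$, a finite nonempty set $A(i)$ of actions at each state $i$, transition probabilities $P_{ij}(u)$ and deterministic costs $c(i,u)\ge 0$ for $u\in A(i)$. A policy $\mu$ assigns to each state $i$ an action $\mu(i)\in A(i)$; let $X^\mu=(X^\mu_k)_{k\ge 0}$ be the Markov chain with transition probabilities $P_{ij}(\mu(i))$ and a fixed initial distribution $p$. Assume: (1) for every policy $\mu$ and every state $i$, $\mathbb P(X^\mu_k=i\text{ for some }k\ge 0)>0$; (2) for all states $i,j$ and all $u,v\in A(i)$, $P_{ij}(u)>0$ if and only if $P_{ij}(v)>0$; (3) $0$ is the unique absorbing state ($P_{00}(u)=1$ for all $u\in A(0)$), $c(0,u)=0$ for all $u\in A(0)$, and the directed graph on $\{1,\dots,n\}$ with an edge $(i,j)$ whenever $P_{ij}(u)>0$ for some $u\in A(i)$ has no directed cycle (loops count as cycles). Let $J^\mu(i)=\mathbb E\big[\sum_{k\ge 0}c(X^\mu_k,\mu(X^\mu_k))\,\big|\,X^\mu_0=i\big]$ and $J^*(i)=\min_\mu J^\mu(i)$.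 Let $\beta:\mathbb N\to[0,\infty)$ satisfy $\sum_t\beta(t)=\infty$ and $\sum_t\beta(t)^2<\infty$. Define random vectors $J_t\in\mathbb R^{n+1}$ as follows. Start with $J_0=0$. At iteration $t=0,1,2,\dots$ choose, on the basis of the past, a greedy policy $\mu_t$, that is, for every state $i$ the action $\mu_t(i)$ minimizes $c(i,u)+\sum_j P_{ij}(u)J_t(j)$ over $u\in A(i)$ (ties are broken arbitrarily). Then sample a trajectory $X^{(t)}=(X^{(t)}_k)_{k\ge 0}$ which, conditionally on the past, is a Markov chain with initial distribution $p$ and transition probabilities $P_{ij}(\mu_t(i))$. For every state $i$ visited by $X^{(t)}$, with first visit at time $N_t(i)$, put $$J_{t+1}(i)=(1-\gamma_t(i))J_t(i)+\gamma_t(i)\sum_{k=N_t(i)}^\infty c\big(X^{(t)}_k,\mu_t(X^{(t)}_k)\big),$$ and put $J_{t+1}(i)=J_t(i)$ for all other states $i$. The step sizes are either $\gamma_t(i)=\beta(t)$ for all $t,i$; or $\gamma_t(i)=\beta(n_t(i))$ for all $t,i$, where $n_t(i)$ is the number of $s<t$ such that $X^{(s)}$ visits $i$, and in this second case $\beta$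 is also assumed to be nonincreasing from some point on. Then, for either choice of the step sizes, $J_t\to J^*$ almost surely as $t\to\infty$. -/

import Mathlib

open MeasureTheory ProbabilityTheory Filter Topology

universe u v w

/-- A Markov decision process with state space `S`, a finite nonempty set of actions at each
state, transition probabilities `P i u j = P_{ij}(u)` and nonnegative deterministic costs
`c i u`. -/
structure FiniteMDP (S : Type u) where
  /-- the set `A(i)` of actions available at state `i` -/
  Action : S → Type v
  [fintypeAction : ∀ i, Fintype (Action i)]
  [nonemptyAction : ∀ i, Nonempty (Action i)]
  /-- `P i u` is the law of the next state when action `u` is taken at state `i` -/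
  P : (i : S) → Action i → PMF S
  c : (i : S) → Action i → ℝ
  c_nonneg : ∀ i u, 0 ≤ c i u

namespace FiniteMDP

attribute [instance] FiniteMDP.fintypeAction FiniteMDP.nonemptyAction

section Policies

variable {S : Type u} (M : FiniteMDP.{u, v} S)

/-- A (stationary, deterministic) policy. -/
abbrev Policy : Type (max u v) := (i : S) → M.Action i

/-- The edges of the one-step reachability graph. -/
def Edge (i j : S) : Prop := ∃ m : M.Policy, 0 < M.P i (m i) j

/-- The set of one-step successors of a state does not depend on the action. -/
def CommonTransitions : Prop :=
  ∀ (i j : S) (u v : M.Action i), 0 < M.P i u j ↔ 0 < M.P i v j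

/-- State `i` is absorbing: under every action the chain stays at `i`. -/
def Absorbing (i : S) : Prop := ∀ u : M.Action i, M.P i u i = 1

/-- `z` is the unique absorbing state, it is cost free, and the subgraph of the reachability
graph induced by the other states has no directed cycle (loops included). -/
structure IsAcyclicSSP (z : S) : Prop where
  absorbing : M.Absorbing z
  unique : ∀ i, M.Absorbing i → i = z
  cost_zero : ∀ u : M.Action z, M.c z u = 0
  acyclic : ∀ i : {s : S // s ≠ z},
    ¬ Relation.TransGen (fun a b : {s : S // s ≠ z} => M.Edge a b) i i

/-- The undiscounted Bellman backup of `J` at state `i` for the action `a`. -/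
noncomputable def backup [Fintype S] (J : S → ℝ) (i : S) (a : M.Action i) : ℝ :=
  M.c i a + ∑ j, (M.P i a j).toReal * J j

/-- `m` is a greedy policy with respect to `J`, that is, `m ∈ argmin_m T_m J`
(the minimum is componentwise; ties may be broken in any way). -/
def IsGreedy [Fintype S] (J : S → ℝ) (m : M.Policy) : Prop :=
  ∀ i, ∀ a : M.Action i, M.backup J i (m i) ≤ M.backup J i a

end Policies

section Chain

variable {S : Type u} [Fintype S] [MeasurableSpace S] [MeasurableSingletonClass S]
  (M : FiniteMDP.{u, v} S)

/-- The one-step transition kernel of the chain `X^m`. -/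
noncomputable def stepKernel (m : M.Policy) : Kernel S S :=
  Kernel.ofFunOfCountable fun i => (M.P i (m i)).toMeasure

instance (m : M.Policy) : IsMarkovKernel (M.stepKernel m) :=
  ⟨fun i => by
    change IsProbabilityMeasure ((M.P i (m i)).toMeasure)
    infer_instance⟩

/-- The transition kernel at time `k`, as a function of the whole history up to time `k`;
it depends on the state at time `k` only. -/
noncomputable def historyKernel (m : M.Policy) (k : ℕ) :
    Kernel ((i : Finset.Iic k) → (fun _ : ℕ => S) i) S :=
  (M.stepKernel m).comap (fun h => h ⟨k, Finset.mem_Iic.2 le_rfl⟩) (measurable_pi_apply _)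

instance (m : M.Policy) (k : ℕ) : IsMarkovKernel (M.historyKernel m k) := by
  unfold historyKernel
  infer_instance

/-- The law, on the space of trajectories, of the Markov chain `X^m` with initial
distribution `p` that follows the policy `m`. -/
noncomputable def trajLaw (p : PMF S) (m : M.Policy) : Measure (ℕ → S) :=
  Kernel.trajMeasure (X := fun _ => S) p.toMeasure (M.historyKernel m)

/-- `q_m(i)`, the probability that the chain ever reaches the state `i`. -/
noncomputable def reachProb (p : PMF S) (m : M.Policy) (i : S) : ENNReal :=
  M.trajLaw p m {x | ∃ k, x k = i}

/-- Every state is reached with positive probability under every policy. -/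
def PositiveReachability (p : PMF S) : Prop :=
  ∀ (m : M.Policy) (i : S), 0 < M.reachProb p m i

/-- `J^m(i)`, the expected cumulative undiscounted cost of the policy `m` from state `i`. -/
noncomputable def costToGo (m : M.Policy) (i : S) : ℝ :=
  ∫ x, ∑' k, M.c (x k) (m (x k)) ∂(M.trajLaw (PMF.pure i) m)

/-- `J^*(i) = min_m J^m(i)`, a minimum over the finitely many policies. -/
noncomputable def optimalCost (i : S) : ℝ := ⨅ m : M.Policy, M.costToGo m i

end Chain

section Algorithm

variable {S : Type u} (M : FiniteMDP.{u, v} S)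

/-- State `i` is visited by the trajectory `x`. -/
def Visits (x : ℕ → S) (i : S) : Prop := ∃ k, x k = i

/-- The first time at which `x` visits `i` (used only when `x` visits `i`). -/
noncomputable def hitTime (x : ℕ → S) (i : S) : ℕ := sInf {k | x k = i}

/-- The cost that the trajectory `x` accumulates under the policy `m` from its first visit
to `i` onwards. -/
noncomputable def tailCost (m : M.Policy) (x : ℕ → S) (i : S) : ℝ :=
  ∑' k, M.c (x (hitTime x i + k)) (m (x (hitTime x i + k)))

open Classical in
/-- The number of trajectories among the first `t` ones that visit `i`. -/
noncomputable def visitCount (x : ℕ → ℕ → S) (t : ℕ) (i : S) : ℕ :=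
  ((Finset.range t).filter fun s => Visits (x s) i).card

open Classical in
/-- One update of the value vector `J`, in all the states visited by the trajectory `x` of the
policy `m`, with step sizes `γ`. -/
noncomputable def update (γ : S → ℝ) (m : M.Policy) (x : ℕ → S) (J : S → ℝ) : S → ℝ :=
  fun i => if Visits x i then (1 - γ i) * J i + γ i * M.tailCost m x i else J i

/-- A run of optimistic policy iteration with step sizes `γ t ω i = γ_t(i)` on a filtered
probability space. `J t` is the value vector, `pol t` the policy and `X t` the trajectory of
iteration `t`; the σ-algebra `ℱ t` is the information available before the `t`-th trajectory is
sampled, and given it the trajectory is a Markov chain that starts from `p` and follows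
`pol t`. -/
structure IsOPIRun [Fintype S] [MeasurableSpace S] [MeasurableSingletonClass S] (p : PMF S)
    {Ω : Type w} {mΩ : MeasurableSpace Ω} (ℙ' : Measure Ω) (ℱ : Filtration ℕ mΩ)
    (γ : ℕ → Ω → S → ℝ) (J : ℕ → Ω → S → ℝ) (pol : ℕ → Ω → M.Policy)
    (X : ℕ → Ω → ℕ → S) : Prop where
  init : ∀ ω, J 0 ω = 0
  greedy : ∀ t ω, M.IsGreedy (J t ω) (pol t ω)
  step : ∀ t ω, J (t + 1) ω = M.update (γ t ω) (pol t ω) (X t ω) (J t ω)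
  pol_measurable : ∀ t (m : M.Policy), MeasurableSet[ℱ t] {ω | pol t ω = m}
  traj_measurable : ∀ t, Measurable[ℱ (t + 1)] (X t)
  traj_law : ∀ t (B : Set (ℕ → S)), MeasurableSet B →
    ℙ'⟦X t ⁻¹' B | ℱ t⟧ =ᵐ[ℙ'] fun ω => (M.trajLaw p (pol t ω)).real B

end Algorithm

end FiniteMDP

/-! Acyclicity lets the coupled asynchronous iteration be solved one state at a time, by induction
on a height that drops along every transition out of a nonabsorbing state.

Fix a state `i`. With `a_t = γ_t(i)` if the trajectory visits `i` and `0` otherwise, the update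
reads `J_{t+1}(i) = (1 - a_t) J_t(i) + a_t J^{μ_t}(i) + w_t`, where `w_t` is `γ_t(i)` times the
difference between the sampled tail cost and `J^{μ_t}(i)`, set to `0` when `i` is not visited. That
difference is a sum of one-step Bellman errors switched on at the first visit (`excess`), so it is
centred given the past. Its weighted squares have a bounded sum, hence `∑ w_t` converges almost
surely. Every policy reaches `i` with probability at least some fixed `q > 0`, hence `∑ a_t = ∞`
almost surely. A pathwise averaging argument then shows that `J_t(i)` converges to any limit that
`J^{μ_t}(i)` has (`ae_tendsto_of_tendsto_costToGo`).

It remains to see that `J^{μ_t}(i) → J^*(i)`. Since `μ_t` is greedy for `J_t`, the gap at `i` is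
bounded by the errors of `J_t` and of `J^{μ_t}` at states of smaller height
(`abs_value_sub_le_of_isGreedy`). Both errors vanish by induction. -/

/-! ### Pathwise stochastic approximation -/

/-- Averaging with step sizes that tend to `0` and have a divergent sum forgets the initial value:
the iterates tend to `0` if the inputs do. -/
theorem tendsto_zero_of_averaging {z a e : ℕ → ℝ} (ha : ∀ t, 0 ≤ a t)
    (ha0 : Tendsto a atTop (𝓝 0))
    (hsum : Tendsto (fun N => ∑ t ∈ Finset.range N, a t) atTop atTop)
    (he : Tendsto e atTop (𝓝 0)) (hz : ∀ t, z (t + 1) = (1 - a t) * z t + a t * e t) :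
    Tendsto z atTop (𝓝 0) := by
  rw [Metric.tendsto_atTop]
  intro ε hε
  have h1 : ∀ᶠ t in atTop, |e t| ≤ ε / 2 ∧ a t ≤ 1 := by
    have h2 : ∀ᶠ t in atTop, a t ≤ 1 := ha0.eventually (ge_mem_nhds one_pos)
    have h3 : ∀ᶠ t in atTop, dist (e t) 0 < ε / 2 :=
      Metric.tendsto_nhds.1 he _ (half_pos hε)
    filter_upwards [h2, h3] with t h2 h3
    rw [Real.dist_eq, sub_zero] at h3
    exact ⟨h3.le, h2⟩
  obtain ⟨T, hT⟩ := eventually_atTop.1 h1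
  set A : ℕ → ℝ := fun N => ∑ t ∈ Finset.range N, a t with hA
  -- Once the inputs are below `ε / 2`, the overshoot `|z t| - ε / 2` is multiplied by at most `1 -
  -- a t ≤ exp (-a t)` at each step.
  have hb : ∀ t, T ≤ t → |z t| - ε / 2 ≤ Real.exp (-(A t - A T)) * |z T| := by
    intro t ht
    induction t, ht using Nat.le_induction with
    | base => simp; linarith [abs_nonneg (z T)]
    | succ t ht ih =>
      obtain ⟨het, hat⟩ := hT t ht
      have h4 : |z (t + 1)| ≤ (1 - a t) * |z t| + a t * (ε / 2) := by
        rw [hz]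
        refine (abs_add_le _ _).trans ?_
        rw [abs_mul, abs_mul, abs_of_nonneg (ha t), abs_of_nonneg (sub_nonneg.2 hat)]
        gcongr
        exact ha t
      have h5 : A (t + 1) = A t + a t := Finset.sum_range_succ _ _
      have h6 : Real.exp (-(A (t + 1) - A T)) =
          Real.exp (-(A t - A T)) * Real.exp (-(a t)) := by
        rw [← Real.exp_add, h5]; congr 1; ring
      have h7 : 1 - a t ≤ Real.exp (-(a t)) := by
        have := Real.add_one_le_exp (-(a t)); linarith
      have hpos : 0 ≤ Real.exp (-(A t - A T)) * |z T| := by positivity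
      calc |z (t + 1)| - ε / 2 ≤ (1 - a t) * (|z t| - ε / 2) := by linarith
        _ ≤ (1 - a t) * (Real.exp (-(A t - A T)) * |z T|) :=
          mul_le_mul_of_nonneg_left ih (sub_nonneg.2 hat)
        _ ≤ Real.exp (-(a t)) * (Real.exp (-(A t - A T)) * |z T|) :=
          mul_le_mul_of_nonneg_right h7 hpos
        _ = _ := by rw [h6]; ring
  have hlim : Tendsto (fun t => Real.exp (-(A t - A T)) * |z T|) atTop (𝓝 0) := by
    have h8 : Tendsto (fun t => Real.exp (-(A t - A T))) atTop (𝓝 0) := by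
      refine Real.tendsto_exp_neg_atTop_nhds_zero.comp ?_
      simpa [sub_eq_add_neg] using tendsto_atTop_add_const_right atTop (-(A T)) hsum
    simpa using h8.mul_const |z T|
  obtain ⟨T', hT'⟩ := eventually_atTop.1 (hlim.eventually (gt_mem_nhds (half_pos hε)))
  refine ⟨max T T', fun t ht => ?_⟩
  rw [Real.dist_eq, sub_zero]
  linarith [hb t (le_trans (le_max_left _ _) ht), hT' t (le_trans (le_max_right _ _) ht)]

/-- Stochastic approximation along a single sample path: the noise enters through the convergent
series `∑ w t`. -/
theorem tendsto_of_stochastic_approximation {y a w e : ℕ → ℝ} {l : ℝ} (ha : ∀ t, 0 ≤ a t)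
    (ha0 : Tendsto a atTop (𝓝 0))
    (hsum : Tendsto (fun N => ∑ t ∈ Finset.range N, a t) atTop atTop)
    (hw : ∃ W, Tendsto (fun N => ∑ t ∈ Finset.range N, w t) atTop (𝓝 W))
    (he : Tendsto e atTop (𝓝 l))
    (hy : ∀ t, y (t + 1) = (1 - a t) * y t + a t * e t + w t) :
    Tendsto y atTop (𝓝 l) := by
  obtain ⟨W, hW⟩ := hw
  -- `r` is the tail of the noise series. Adding it to `y - l` absorbs the noise: the sum satisfies
  -- the noiseless recursion with input `e - l + r`, which tends to `0`.
  set r : ℕ → ℝ := fun N => W - ∑ t ∈ Finset.range N, w t with hr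
  have hr0 : Tendsto r atTop (𝓝 0) := by simpa using hW.const_sub W
  have he' : Tendsto (fun t => e t - l + r t) atTop (𝓝 0) := by
    simpa using (he.sub_const l).add hr0
  have hz := tendsto_zero_of_averaging (z := fun t => y t - l + r t) ha ha0 hsum he' (by
    intro t
    have : r (t + 1) = r t - w t := by simp only [hr, Finset.sum_range_succ]; ring
    simp only [this, hy]; ring)
  have := (hz.sub hr0).add_const l
  simpa using this

/-! ### Convergence of square-bounded martingale series -/

section MartingaleSums

variable {Ω : Type*} {mΩ : MeasurableSpace Ω} {μ : Measure Ω} [IsProbabilityMeasure μ]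
  {ℱ : Filtration ℕ mΩ} {ξ : ℕ → Ω → ℝ}

/-- A series of bounded martingale differences whose squares have a bounded sum converges almost
surely. -/
theorem ae_exists_tendsto_sum_of_martingale_difference
    (hmeas : ∀ t, StronglyMeasurable[ℱ (t + 1)] (ξ t))
    (hbdd : ∀ t, ∃ C, ∀ ω, |ξ t ω| ≤ C)
    (hcond : ∀ t, μ[ξ t | ℱ t] =ᵐ[μ] 0)
    {B : ℝ} (hsq : ∀ N ω, ∑ t ∈ Finset.range N, ξ t ω ^ 2 ≤ B) :
    ∀ᵐ ω ∂μ, ∃ W, Tendsto (fun N => ∑ t ∈ Finset.range N, ξ t ω) atTop (𝓝 W) := by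
  choose C hC using hbdd
  set f : ℕ → Ω → ℝ := fun N ω => ∑ t ∈ Finset.range N, ξ t ω with hf
  have hξm : ∀ t, StronglyMeasurable (ξ t) := fun t => (hmeas t).mono (ℱ.le _)
  have hfad : ∀ N, StronglyMeasurable[ℱ N] (f N) := by
    intro N
    refine Finset.stronglyMeasurable_fun_sum _ fun t ht => ?_
    exact (hmeas t).mono (ℱ.mono (Finset.mem_range.1 ht))
  have hfm : ∀ N, StronglyMeasurable (f N) := fun N => (hfad N).mono (ℱ.le _)
  have hfb : ∀ N ω, |f N ω| ≤ ∑ t ∈ Finset.range N, C t := fun N ω =>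
    (Finset.abs_sum_le_sum_abs _ _).trans (Finset.sum_le_sum fun t _ => hC t ω)
  have hint : ∀ {g : Ω → ℝ} {D : ℝ}, StronglyMeasurable g → (∀ ω, |g ω| ≤ D) → Integrable g μ :=
    fun hg hD => Integrable.of_bound hg.aestronglyMeasurable _ (ae_of_all _ hD)
  have hξi : ∀ t, Integrable (ξ t) μ := fun t => hint (hξm t) (hC t)
  have hfi : ∀ N, Integrable (f N) μ := fun N => hint (hfm N) (hfb N)
  have hmart : Martingale f ℱ μ := by
    refine martingale_nat hfad hfi fun N => ?_
    have h1 : f (N + 1) = f N + ξ N := by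
      ext ω; simp [hf, Finset.sum_range_succ]
    rw [h1]
    have h2 := condExp_add (hfi N) (hξi N) (ℱ N)
    have h3 : μ[f N | ℱ N] = f N := condExp_of_stronglyMeasurable (ℱ.le N) (hfad N) (hfi N)
    filter_upwards [h2, hcond N] with ω h2 h4
    rw [h2, Pi.add_apply, h3, h4]; simp
  have hprod : ∀ N, Integrable (fun ω => f N ω * ξ N ω) μ := by
    intro N
    refine hint (D := (∑ t ∈ Finset.range N, C t) * C N) ((hfm N).mul (hξm N)) fun ω => ?_
    rw [abs_mul]
    exact mul_le_mul (hfb N ω) (hC N ω) (abs_nonneg _) ((abs_nonneg _).trans (hfb N ω))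
  have hcross : ∀ N, ∫ ω, f N ω * ξ N ω ∂μ = 0 := by
    intro N
    have h1 : μ[f N * ξ N | ℱ N] =ᵐ[μ] f N * μ[ξ N | ℱ N] :=
      condExp_mul_of_stronglyMeasurable_left (hfad N) (hprod N) (hξi N)
    have h2 : ∫ ω, (f N * ξ N) ω ∂μ = ∫ ω, (μ[f N * ξ N | ℱ N]) ω ∂μ :=
      (integral_condExp (ℱ.le N)).symm
    change ∫ ω, (f N * ξ N) ω ∂μ = 0
    rw [h2]
    refine integral_eq_zero_of_ae ?_
    filter_upwards [h1, hcond N] with ω h1 h3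
    rw [h1, Pi.mul_apply, h3]; simp
  have hsqi : ∀ {g : Ω → ℝ} {D : ℝ}, StronglyMeasurable g → (∀ ω, |g ω| ≤ D) →
      Integrable (fun ω => g ω ^ 2) μ := by
    intro g D hg hD
    refine hint (D := D ^ 2) (hg.pow 2) fun ω => ?_
    rw [abs_pow]
    exact pow_le_pow_left₀ (abs_nonneg _) (hD ω) 2
  -- Orthogonality of the increments: the cross terms vanish by `hcross`.
  have hsecond : ∀ N, ∫ ω, f N ω ^ 2 ∂μ = ∫ ω, ∑ t ∈ Finset.range N, ξ t ω ^ 2 ∂μ := by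
    intro N
    induction N with
    | zero => simp [hf]
    | succ N ih =>
      have h1 : (fun ω => f (N + 1) ω ^ 2) =
          fun ω => (f N ω ^ 2 + 2 * (f N ω * ξ N ω)) + ξ N ω ^ 2 := by
        ext ω; simp only [hf, Finset.sum_range_succ]; ring
      simp_rw [Finset.sum_range_succ]
      have h2 : Integrable (fun ω => f N ω ^ 2 + 2 * (f N ω * ξ N ω)) μ :=
        (hsqi (hfm N) (hfb N)).add ((hprod N).const_mul 2)
      rw [h1, integral_add h2 (hsqi (hξm N) (hC N)), integral_add (hsqi (hfm N) (hfb N)) ((hprod N).const_mul 2),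
        integral_const_mul, hcross, ih, integral_add
          (integrable_finsetSum _ fun t _ => hsqi (hξm t) (hC t)) (hsqi (hξm N) (hC N))]
      ring
  have hsecondB : ∀ N, ∫ ω, f N ω ^ 2 ∂μ ≤ B := by
    intro N
    rw [hsecond]
    calc ∫ ω, ∑ t ∈ Finset.range N, ξ t ω ^ 2 ∂μ ≤ ∫ _, B ∂μ :=
          integral_mono (integrable_finsetSum _ fun t _ => hsqi (hξm t) (hC t))
            (integrable_const _) (hsq N)
      _ = B := by simp
  -- The martingale convergence theorem needs an `L¹` bound; it follows from the `L²` bound by `|x|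
  -- ≤ 1 + x ^ 2`.
  have hL1 : ∀ N, eLpNorm (f N) 1 μ ≤ ((1 + B).toNNReal : ENNReal) := by
    intro N
    rw [eLpNorm_one_eq_lintegral_enorm, ← ofReal_integral_norm_eq_lintegral_enorm (hfi N)]
    refine ENNReal.ofReal_le_ofReal ?_
    calc ∫ ω, ‖f N ω‖ ∂μ ≤ ∫ ω, (1 + f N ω ^ 2) ∂μ := by
          refine integral_mono (hfi N).norm
            ((integrable_const _).add (hsqi (hfm N) (hfb N))) fun ω => ?_
          simp only [Real.norm_eq_abs]
          nlinarith [sq_nonneg (|f N ω| - 1), sq_abs (f N ω), abs_nonneg (f N ω)]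
      _ = 1 + ∫ ω, f N ω ^ 2 ∂μ := by
          rw [integral_add (integrable_const _) (hsqi (hfm N) (hfb N))]; simp
      _ ≤ 1 + B := by linarith [hsecondB N]
  exact hmart.submartingale.exists_ae_tendsto_of_bdd hL1

end MartingaleSums

/-! ### The law of a trajectory -/

namespace FiniteMDP

section TrajectoryLaw

variable {S : Type u} [Fintype S] [MeasurableSpace S] [MeasurableSingletonClass S]
  (M : FiniteMDP.{u, v} S) (p : PMF S) (m : M.Policy)

instance : IsProbabilityMeasure (M.trajLaw p m) := by
  unfold trajLaw
  infer_instance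

/-- The one-step Markov property: a function of the transition at time `k` that is centred given
the state at time `k` is orthogonal to the past. -/
theorem integral_trajLaw_transition_eq_zero (k : ℕ) (g : (Finset.Iic k → S) → ℝ)
    (φ : S → S → ℝ) (hφ : ∀ i, ∑ j, (M.P i (m i) j).toReal * φ i j = 0) :
    ∫ x, g (Preorder.frestrictLe (π := fun _ => S) k x) * φ (x k) (x (k + 1))
      ∂(M.trajLaw p m) = 0 := by
  let last : Finset.Iic k := ⟨k, Finset.mem_Iic.2 le_rfl⟩
  let G : (Finset.Iic k → S) × S → ℝ := fun q => g q.1 * φ (q.1 last) q.2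
  have hG : Measurable G := Measurable.of_discrete
  have hmap := Kernel.map_frestrictLe_trajMeasure_compProd_eq_map_trajMeasure
    (X := fun _ => S) (μ₀ := p.toMeasure) (κ := M.historyKernel m) (a := k)
  have h1 : ∫ x, G (Preorder.frestrictLe (π := fun _ => S) k x, x (k + 1)) ∂(M.trajLaw p m) =
      ∫ q, G q ∂((M.trajLaw p m).map
        fun x => (Preorder.frestrictLe (π := fun _ => S) k x, x (k + 1))) := by
    rw [integral_map (by fun_prop) hG.aestronglyMeasurable]
  change ∫ x, G (Preorder.frestrictLe (π := fun _ => S) k x, x (k + 1)) ∂(M.trajLaw p m) = 0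
  rw [h1]
  have h2 : (M.trajLaw p m).map
        (fun x => (Preorder.frestrictLe (π := fun _ => S) k x, x (k + 1))) =
      (M.trajLaw p m).map (Preorder.frestrictLe (π := fun _ => S) k) ⊗ₘ M.historyKernel m k :=
    hmap.symm
  have hprob : IsProbabilityMeasure
      ((M.trajLaw p m).map (Preorder.frestrictLe (π := fun _ => S) k)) :=
    Measure.isProbabilityMeasure_map (by fun_prop)
  rw [h2, Measure.integral_compProd (Integrable.of_finite)]
  refine integral_eq_zero_of_ae (ae_of_all _ fun h => ?_)
  have h3 : M.historyKernel m k h = (M.P (h last) (m (h last))).toMeasure := rfl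
  change ∫ y, g h * φ (h last) y ∂(M.historyKernel m k h) = 0
  rw [h3, integral_const_mul, PMF.integral_eq_sum]
  simp only [smul_eq_mul, hφ, mul_zero]

/-- A trajectory which uses only transitions of positive probability. -/
def IsPath (x : ℕ → S) : Prop := ∀ k, 0 < M.P (x k) (m (x k)) (x (k + 1))

theorem ae_isPath : ∀ᵐ x ∂(M.trajLaw p m), M.IsPath m x := by
  classical
  unfold IsPath
  rw [ae_all_iff]
  intro k
  -- The indicator of impossible transitions is centred in the required sense, because each term of
  -- its mean has a zero factor; being nonnegative, it then vanishes almost surely.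
  let φ : S → S → ℝ := fun i j => if M.P i (m i) j = 0 then 1 else 0
  have h0 := M.integral_trajLaw_transition_eq_zero p m k (fun _ => 1) φ (by
    intro i
    refine Finset.sum_eq_zero fun j _ => ?_
    by_cases h : M.P i (m i) j = 0 <;> simp [φ, h])
  simp only [one_mul] at h0
  have hφ : ∀ i j, 0 ≤ φ i j ∧ φ i j ≤ 1 := by
    intro i j
    simp only [φ]
    split_ifs <;> norm_num
  have hm : Measurable fun x : ℕ → S => φ (x k) (x (k + 1)) := by
    have hpair : Measurable fun x : ℕ → S => (x k, x (k + 1)) := by fun_prop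
    exact (Measurable.of_discrete (f := fun q : S × S => φ q.1 q.2)).comp hpair
  rw [integral_eq_zero_iff_of_nonneg (fun x => (hφ _ _).1)
    (Integrable.of_bound hm.aestronglyMeasurable 1 (ae_of_all _ fun x => by
      rw [Real.norm_eq_abs, abs_of_nonneg (hφ _ _).1]; exact (hφ _ _).2))] at h0
  filter_upwards [h0] with x hx
  rw [pos_iff_ne_zero]
  intro h
  simp [φ, h] at hx

theorem ae_trajLaw_pure_zero (i : S) : ∀ᵐ x ∂(M.trajLaw (PMF.pure i) m), x 0 = i := by
  have h1 : (M.trajLaw (PMF.pure i) m).map (Preorder.frestrictLe (π := fun _ => S) 0) =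
      ((PMF.pure i).toMeasure).map
        (MeasurableEquiv.piUnique (fun _ : Finset.Iic 0 => S)).symm := by
    unfold trajLaw Kernel.trajMeasure
    rw [Measure.map_comp _ _ (by fun_prop), Kernel.traj_map_frestrictLe, Kernel.partialTraj_self,
      Measure.id_comp]
  have h2 : ∀ᵐ h ∂((M.trajLaw (PMF.pure i) m).map (Preorder.frestrictLe (π := fun _ => S) 0)),
      h ⟨0, by simp⟩ = i := by
    rw [h1, PMF.toMeasure_pure]
    refine (ae_map_iff (MeasurableEquiv.measurable _).aemeasurable MeasurableSet.of_discrete).2 ?_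
    refine (ae_dirac_iff MeasurableSet.of_discrete).2 rfl
  exact ae_of_ae_map (by fun_prop) h2

end TrajectoryLaw

end FiniteMDP

/-! ### Heights and absorption -/

namespace FiniteMDP

section Height

variable {S : Type u} {M : FiniteMDP.{u, v} S} {z : S}

/-- `h` strictly decreases along the transitions out of the states other than `z`. -/
def IsHeight (M : FiniteMDP.{u, v} S) (z : S) (h : S → ℕ) : Prop :=
  ∀ i, i ≠ z → ∀ (a : M.Action i) (j : S), 0 < M.P i a j → h j < h i

theorem edge_of_pos {i j : S} (a : M.Action i) (ha : 0 < M.P i a j) : M.Edge i j := by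
  classical
  exact ⟨Function.update (fun _ => Classical.arbitrary _) i a, by simpa using ha⟩

theorem IsAcyclicSSP.exists_isHeight [Finite S] (hssp : M.IsAcyclicSSP z) :
    ∃ h, M.IsHeight z h := by
  -- Transitions out of `z` are cut, which removes its loop and makes the relation well-founded.
  let R : S → S → Prop := fun j i => i ≠ z ∧ M.Edge i j
  let Q : {s : S // s ≠ z} → {s : S // s ≠ z} → Prop :=
    Relation.TransGen fun b a => M.Edge a b
  have hQirr : Std.Irrefl Q := by
    refine ⟨fun i hi => hssp.acyclic i ?_⟩
    have := Relation.transGen_swap.1 hi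
    exact this
  have hQ : WellFounded Q := by
    have : IsTrans _ Q := ⟨fun _ _ _ => Relation.TransGen.trans⟩
    exact Finite.wellFounded_of_trans_of_irrefl Q
  have hz : Acc R z := ⟨_, fun y hy => absurd rfl hy.1⟩
  have hR : WellFounded R := by
    refine ⟨fun i => ?_⟩
    by_cases hi : i = z
    · rw [hi]; exact hz
    · have key : ∀ s : {s : S // s ≠ z}, Acc R s := by
        intro s
        induction s using hQ.induction with
        | _ s ih =>
          refine ⟨_, fun y hy => ?_⟩
          by_cases hyz : y = z
          · rw [hyz]; exact hz
          · exact ih ⟨y, hyz⟩ (Relation.TransGen.single hy.2)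
      exact key ⟨i, hi⟩
  -- The height counts the proper descendants. It drops strictly from `i` to a successor `j`, since
  -- `j` is a descendant of `i` but not of itself.
  refine ⟨fun i => {j | Relation.TransGen R j i}.ncard, fun i hi a j hj => ?_⟩
  have hji : R j i := ⟨hi, edge_of_pos a hj⟩
  have hsub : {k | Relation.TransGen R k j} ⊆ {k | Relation.TransGen R k i} :=
    fun k hk => Relation.TransGen.tail hk hji
  refine Set.ncard_lt_ncard ((Set.ssubset_iff_of_subset hsub).2 ?_) (Set.toFinite _)
  exact ⟨j, Relation.TransGen.single hji, fun hjj => hR.transGen.irrefl.irrefl j hjj⟩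

theorem prob_eq_zero_of_ne (hssp : M.IsAcyclicSSP z) (a : M.Action z) {j : S} (hj : j ≠ z) :
    M.P z a j = 0 := by
  have h1 := hssp.absorbing a
  rw [PMF.apply_eq_one_iff] at h1
  rw [PMF.apply_eq_zero_iff, h1]
  exact hj

/-- A trajectory is absorbed in `z` by any time larger than the height of all states. -/
theorem IsPath.eq_absorbing (hssp : M.IsAcyclicSSP z) {h : S → ℕ} (hh : M.IsHeight z h)
    {m : M.Policy} {x : ℕ → S} (hx : M.IsPath m x) {K : ℕ} (hK : ∀ i, h i < K) {k : ℕ}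
    (hk : K ≤ k) : x k = z := by
  have hstay : ∀ k, x k = z → x (k + 1) = z := by
    intro k hk
    by_contra hne
    have := hx k
    have h0 : M.P (x k) (m (x k)) (x (k + 1)) = 0 := by
      generalize m (x k) = a
      revert a
      rw [hk]
      exact fun a => prob_eq_zero_of_ne hssp a hne
    exact this.ne' h0
  have hmono : ∀ k, x k = z ∨ h (x k) + k ≤ h (x 0) := by
    intro k
    induction k with
    | zero => right; simp
    | succ k ih =>
      by_cases hk : x k = z
      · exact Or.inl (hstay k hk)
      · right
        have := hh (x k) hk _ _ (hx k)
        rcases ih with ih | ih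
        · exact absurd ih hk
        · omega
  rcases hmono k with h1 | h1
  · exact h1
  · have := hK (x 0); omega

end Height

/-! ### Bellman equations solved by recursion on the height -/

/-- An operator whose value at a state only depends on the states of smaller height has a fixed
point. -/
theorem exists_fixedPoint_of_height {S : Type*} (h : S → ℕ) (F : (S → ℝ) → S → ℝ)
    (hF : ∀ J J' i, (∀ j, h j < h i → J j = J' j) → F J i = F J' i) :
    ∃ V, ∀ i, V i = F V i := by
  -- Iteration from `0` is stationary at `i` from step `h i + 1` on.
  have key : ∀ k i, h i < k → F^[k] 0 i = F^[h i + 1] 0 i := by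
    intro k
    induction k using Nat.strong_induction_on with
    | _ k ih =>
      intro i hi
      obtain ⟨k, rfl⟩ : ∃ l, k = l + 1 := ⟨k - 1, by omega⟩
      rw [Function.iterate_succ_apply', Function.iterate_succ_apply']
      refine hF _ _ _ fun j hj => ?_
      rw [ih k (by omega) j (by omega), ih (h i) (by omega) j hj]
  refine ⟨fun i => F^[h i + 1] 0 i, fun i => ?_⟩
  change F^[h i + 1] 0 i = _
  rw [Function.iterate_succ_apply']
  exact hF _ _ _ fun j hj => key _ _ hj

section Bellman

variable {S : Type u} [Fintype S] {M : FiniteMDP.{u, v} S} {z : S}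

theorem sum_toReal_eq_one (q : PMF S) : ∑ j, (q j).toReal = 1 := by
  rw [← ENNReal.toReal_sum fun j _ => q.apply_ne_top j, ← tsum_fintype (L := .unconditional S),
    q.tsum_coe, ENNReal.toReal_one]

theorem backup_absorbing (hssp : M.IsAcyclicSSP z) (J : S → ℝ) (a : M.Action z) :
    M.backup J z a = J z := by
  unfold backup
  rw [hssp.cost_zero, Finset.sum_eq_single z]
  · simp [hssp.absorbing a]
  · intro j _ hj
    simp [prob_eq_zero_of_ne hssp a hj]
  · simp

theorem backup_congr {h : S → ℕ} (hh : M.IsHeight z h) {i : S} (hi : i ≠ z) (a : M.Action i)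
    {J J' : S → ℝ} (hJ : ∀ j, h j < h i → J j = J' j) : M.backup J i a = M.backup J' i a := by
  unfold backup
  congr 1
  refine Finset.sum_congr rfl fun j _ => ?_
  by_cases h0 : M.P i a j = 0
  · simp [h0]
  · rw [hJ j (hh i hi a j (pos_iff_ne_zero.2 h0))]

theorem backup_mono {h : S → ℕ} (hh : M.IsHeight z h) {i : S} (hi : i ≠ z) (a : M.Action i)
    {J J' : S → ℝ} (hJ : ∀ j, h j < h i → J j ≤ J' j) : M.backup J i a ≤ M.backup J' i a := by
  unfold backup
  refine add_le_add_right (Finset.sum_le_sum fun j _ => ?_) _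
  by_cases h0 : M.P i a j = 0
  · simp [h0]
  · exact mul_le_mul_of_nonneg_left (hJ j (hh i hi a j (pos_iff_ne_zero.2 h0)))
      ENNReal.toReal_nonneg

theorem abs_backup_sub_le {h : S → ℕ} (hh : M.IsHeight z h) {i : S} (hi : i ≠ z)
    (a : M.Action i) (J J' : S → ℝ) :
    |M.backup J i a - M.backup J' i a| ≤ ∑ j with h j < h i, |J j - J' j| := by
  unfold backup
  rw [add_sub_add_left_eq_sub, ← Finset.sum_sub_distrib, Finset.sum_filter]
  refine (Finset.abs_sum_le_sum_abs _ _).trans (Finset.sum_le_sum fun j _ => ?_)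
  rw [← mul_sub, abs_mul, abs_of_nonneg ENNReal.toReal_nonneg]
  by_cases h0 : M.P i a j = 0
  · simp only [h0, ENNReal.toReal_zero, zero_mul]
    split_ifs <;> positivity
  · rw [if_pos (hh i hi a j (pos_iff_ne_zero.2 h0))]
    refine mul_le_of_le_one_left (abs_nonneg _) ?_
    exact ENNReal.toReal_mono ENNReal.one_ne_top (PMF.coe_le_one _ _)

/-- `V` solves the evaluation equations of the policy `m`. -/
structure IsPolicyValue (M : FiniteMDP.{u, v} S) (z : S) (m : M.Policy) (V : S → ℝ) : Prop where
  absorbing : V z = 0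
  eq_backup : ∀ i, V i = M.backup V i (m i)

theorem exists_isPolicyValue (hssp : M.IsAcyclicSSP z) (m : M.Policy) :
    ∃ V, M.IsPolicyValue z m V := by
  classical
  obtain ⟨h, hh⟩ := hssp.exists_isHeight
  obtain ⟨V, hV⟩ := exists_fixedPoint_of_height h
    -- At `z` the backup equation holds for every `J`, so the value `0` has to be imposed there.
    (fun J i => if i = z then 0 else M.backup J i (m i)) (by
      intro J J' i hJ
      by_cases hi : i = z
      · simp [hi]
      · simp only [hi, if_false]
        exact backup_congr hh hi _ hJ)
  have hz : V z = 0 := by rw [hV]; simp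
  refine ⟨V, hz, fun i => ?_⟩
  by_cases hi : i = z
  · subst hi
    rw [backup_absorbing hssp]
  · rw [hV]; simp only [hi, if_false]

/-- `V` solves the Bellman optimality equations. -/
structure IsOptimalValue (M : FiniteMDP.{u, v} S) (z : S) (V : S → ℝ) : Prop where
  absorbing : V z = 0
  le_backup : ∀ i a, V i ≤ M.backup V i a
  exists_eq : ∀ i, ∃ a, V i = M.backup V i a

theorem exists_isOptimalValue (hssp : M.IsAcyclicSSP z) : ∃ V, M.IsOptimalValue z V := by
  classical
  obtain ⟨h, hh⟩ := hssp.exists_isHeight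
  obtain ⟨V, hV⟩ := exists_fixedPoint_of_height h
    (fun J i => if i = z then 0 else ⨅ a, M.backup J i a) (by
      intro J J' i hJ
      by_cases hi : i = z
      · simp [hi]
      · simp only [hi, if_false]
        exact iInf_congr fun a => backup_congr hh hi a hJ)
  have hz : V z = 0 := by rw [hV]; simp
  have hV' : ∀ i, V i = ⨅ a, M.backup V i a := by
    intro i
    by_cases hi : i = z
    · subst hi
      simp_rw [backup_absorbing hssp]
      simp
    · rw [hV]; simp only [hi, if_false]
  refine ⟨V, hz, fun i a => ?_, fun i => ?_⟩
  · rw [hV' i]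
    exact ciInf_le (Set.finite_range _).bddBelow a
  · obtain ⟨a, ha⟩ := exists_eq_ciInf_of_finite (f := fun a => M.backup V i a)
    exact ⟨a, (hV' i).trans ha.symm⟩

theorem IsOptimalValue.le (hssp : M.IsAcyclicSSP z) {V W : S → ℝ} (hV : M.IsOptimalValue z V)
    {m : M.Policy} (hW : M.IsPolicyValue z m W) (i : S) : V i ≤ W i := by
  obtain ⟨h, hh⟩ := hssp.exists_isHeight
  induction hn : h i using Nat.strong_induction_on generalizing i with
  | _ n ih =>
    by_cases hi : i = z
    · rw [hi, hV.absorbing, hW.absorbing]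
    · rw [hW.eq_backup]
      exact (hV.le_backup i (m i)).trans
        (backup_mono hh hi _ fun j hj => ih (h j) (hn ▸ hj) j rfl)

/-- A policy that is greedy for `J` is as good as `J` and its own values at the states of smaller
height are. -/
theorem abs_value_sub_le_of_isGreedy (hssp : M.IsAcyclicSSP z) {h : S → ℕ}
    (hh : M.IsHeight z h) {V W J : S → ℝ} {m : M.Policy} (hV : M.IsOptimalValue z V)
    (hW : M.IsPolicyValue z m W) (hm : M.IsGreedy J m) {i : S} (hi : i ≠ z) :
    |W i - V i| ≤ (∑ j with h j < h i, |W j - V j|) +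
      2 * ∑ j with h j < h i, |J j - V j| := by
  obtain ⟨a, ha⟩ := hV.exists_eq i
  -- Optimality makes the difference nonnegative. The comparison of `m i` with the optimal action
  -- `a` passes through the backups of `J`; replacing `V` by `J` once for each action gives the
  -- factor `2`.
  rw [abs_of_nonneg (sub_nonneg.2 (hV.le hssp hW i))]
  have h1 := abs_le.1 (abs_backup_sub_le hh hi (m i) W V)
  have h2 := abs_le.1 (abs_backup_sub_le hh hi (m i) J V)
  have h3 := abs_le.1 (abs_backup_sub_le hh hi a J V)
  have h4 := hm i a
  rw [hW.eq_backup i]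
  linarith [h1.2, h2.1, h3.2]

end Bellman

/-! ### The sampling error as a sum of centred one-step errors -/

section Excess

variable {S : Type u} {M : FiniteMDP.{u, v} S} {z : S}

open Classical in
/-- The one-step evaluation errors of `V`, accumulated from the first visit to `i` up to
time `K`. -/
noncomputable def excess (M : FiniteMDP.{u, v} S) (m : M.Policy) (V : S → ℝ) (K : ℕ) (i : S)
    (x : ℕ → S) : ℝ :=
  ∑ k ∈ Finset.range K, (if ∃ l ≤ k, x l = i then 1 else 0) *
    (M.c (x k) (m (x k)) + V (x (k + 1)) - V (x k))

-- The values of `V` telescope from the first visit to `i` up to time `K`, when the path has been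
-- absorbed and `V` is `0`; what remains is the tail cost minus `V i`.
open Classical in
theorem IsPath.excess_eq (hssp : M.IsAcyclicSSP z) {h : S → ℕ} (hh : M.IsHeight z h)
    {m : M.Policy} {x : ℕ → S} (hx : M.IsPath m x) {K : ℕ} (hK : ∀ i, h i < K) {V : S → ℝ}
    (hV : V z = 0) (i : S) :
    M.excess m V K i x = if Visits x i then M.tailCost m x i - V i else 0 := by
  by_cases hvis : Visits x i
  · rw [if_pos hvis]
    have hmem : x (hitTime x i) = i := Nat.sInf_mem (s := {k | x k = i}) hvis
    have hmin : ∀ k, x k = i → hitTime x i ≤ k := fun k hk => Nat.sInf_le hk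
    set N := hitTime x i with hN
    have hNK : N ≤ K := by
      by_contra hlt
      push Not at hlt
      have h1 := hx.eq_absorbing hssp hh hK hlt.le
      have h2 := hx.eq_absorbing hssp hh hK le_rfl
      exact absurd (hmin K (by rw [h2, ← h1, hmem])) (by omega)
    obtain ⟨L, rfl⟩ := Nat.exists_eq_add_of_le hNK
    have hc : ∀ k, L ≤ k → M.c (x (N + k)) (m (x (N + k))) = 0 := by
      intro k hk
      have h1 : x (N + k) = z := hx.eq_absorbing hssp hh hK (by omega)
      rw [h1]
      exact hssp.cost_zero _
    have htail : M.tailCost m x i =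
        ∑ k ∈ Finset.range L, M.c (x (N + k)) (m (x (N + k))) := by
      unfold tailCost
      rw [← hN]
      refine tsum_eq_sum fun k hk => hc k ?_
      simpa using hk
    have hex : M.excess m V (N + L) i x = ∑ k ∈ Finset.range L,
        (M.c (x (N + k)) (m (x (N + k))) + (V (x (N + (k + 1))) - V (x (N + k)))) := by
      unfold excess
      rw [Finset.sum_range_add, Finset.sum_eq_zero, zero_add]
      · refine Finset.sum_congr rfl fun k _ => ?_
        rw [if_pos ⟨N, by omega, hmem⟩, add_assoc N k 1]
        ring
      · intro k hk
        rw [if_neg, zero_mul]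
        rintro ⟨l, hl, hl'⟩
        have := hmin l hl'
        have := Finset.mem_range.1 hk
        omega
    rw [hex, htail, Finset.sum_add_distrib, Finset.sum_range_sub (fun k => V (x (N + k))),
      hx.eq_absorbing hssp hh hK (le_refl (N + L)), hV, add_zero, hmem]
    ring
  · rw [if_neg hvis]
    unfold excess
    refine Finset.sum_eq_zero fun k _ => ?_
    rw [if_neg, zero_mul]
    rintro ⟨l, -, hl⟩
    exact hvis ⟨l, hl⟩

-- The bound vanishes off the visits to `i`; this is needed because the squared step sizes are
-- controlled only along those visits.
open Classical in
theorem exists_abs_excess_le [Finite S] (m : M.Policy) (V : S → ℝ) (K : ℕ) :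
    ∃ C, 0 ≤ C ∧ ∀ i x, |M.excess m V K i x| ≤ if Visits x i then C else 0 := by
  obtain ⟨G, hG⟩ := (Set.finite_range fun q : S × S =>
    |M.c q.1 (m q.1) + V q.2 - V q.1|).bddAbove
  have hG' : ∀ i j, |M.c i (m i) + V j - V i| ≤ G := fun i j => hG ⟨(i, j), rfl⟩
  refine ⟨K * |G|, by positivity, fun i x => ?_⟩
  unfold excess
  refine (Finset.abs_sum_le_sum_abs _ _).trans ?_
  by_cases hvis : Visits x i
  · rw [if_pos hvis]
    calc _ ≤ ∑ k ∈ Finset.range K, |G| := by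
          refine Finset.sum_le_sum fun k _ => ?_
          rw [abs_mul]
          have h1 := (hG' (x k) (x (k + 1))).trans (le_abs_self G)
          split_ifs
          · simpa using h1
          · simp
      _ = K * |G| := by simp
  · rw [if_neg hvis]
    refine (Finset.sum_eq_zero fun k _ => ?_).le
    rw [if_neg, zero_mul, abs_zero]
    rintro ⟨l, -, hl⟩
    exact hvis ⟨l, hl⟩

variable [Fintype S] [MeasurableSpace S] [MeasurableSingletonClass S]

open Classical in
theorem measurable_excess (m : M.Policy) (V : S → ℝ) (K : ℕ) (i : S) :
    Measurable (M.excess m V K i) := by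
  unfold excess
  refine Finset.measurable_fun_sum _ fun k _ => Measurable.mul ?_ ?_
  · refine Measurable.ite ?_ measurable_const measurable_const
    have : {x : ℕ → S | ∃ l ≤ k, x l = i} = ⋃ l, ⋃ (_ : l ≤ k), (fun x => x l) ⁻¹' {i} := by
      ext x; simp
    rw [this]
    exact MeasurableSet.iUnion fun l => MeasurableSet.iUnion fun _ =>
      measurable_pi_apply l (measurableSet_singleton i)
  · have hpair : Measurable fun x : ℕ → S => (x k, x (k + 1)) := by fun_prop
    exact (Measurable.of_discrete
      (f := fun q : S × S => M.c q.1 (m q.1) + V q.2 - V q.1)).comp hpair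

theorem integrable_excess (μ : Measure (ℕ → S)) [IsFiniteMeasure μ] (m : M.Policy) (V : S → ℝ)
    (K : ℕ) (i : S) : Integrable (M.excess m V K i) μ := by
  classical
  obtain ⟨C, hC, hb⟩ := M.exists_abs_excess_le m V K
  refine Integrable.of_bound (measurable_excess m V K i).aestronglyMeasurable C
    (ae_of_all _ fun x => (hb i x).trans ?_)
  split_ifs <;> simp [hC]

/-- Whether `i` has been visited by time `k` is decided by the past, while the evaluation equation
centres the next one-step error. The one-step Markov property therefore kills each term. -/
theorem IsPolicyValue.integral_excess {m : M.Policy} {V : S → ℝ} (hV : M.IsPolicyValue z m V)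
    (p : PMF S) (K : ℕ) (i : S) : ∫ x, M.excess m V K i x ∂(M.trajLaw p m) = 0 := by
  classical
  induction K with
  | zero => simp [excess]
  | succ K ih =>
    have h1 : ∀ x, M.excess m V (K + 1) i x = M.excess m V K i x +
        (M.excess m V (K + 1) i x - M.excess m V K i x) := fun x => by ring
    have h2 : ∀ x, M.excess m V (K + 1) i x - M.excess m V K i x =
        (fun y : Finset.Iic K → S => if ∃ l, y l = i then (1 : ℝ) else 0)
          (Preorder.frestrictLe (π := fun _ => S) K x) *
        (fun s j => M.c s (m s) + V j - V s) (x K) (x (K + 1)) := by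
      intro x
      have h3 : (∃ l : Finset.Iic K, Preorder.frestrictLe (π := fun _ => S) K x l = i) ↔
          ∃ l ≤ K, x l = i := by
        simp [Preorder.frestrictLe]
      simp only [excess, Finset.sum_range_succ, add_sub_cancel_left, h3]
    have hdiff : Integrable (fun x => M.excess m V (K + 1) i x - M.excess m V K i x)
        (M.trajLaw p m) :=
      (integrable_excess _ m V (K + 1) i).sub (integrable_excess _ m V K i)
    rw [integral_congr_ae (ae_of_all _ h1), integral_add (integrable_excess _ m V K i) hdiff,
      ih, zero_add, integral_congr_ae (ae_of_all _ h2)]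
    refine M.integral_trajLaw_transition_eq_zero p m K
      (fun y : Finset.Iic K → S => if ∃ l, y l = i then (1 : ℝ) else 0)
      (fun s j => M.c s (m s) + V j - V s) fun s => ?_
    have h4 := hV.eq_backup s
    unfold backup at h4
    have h5 : ∀ j, (M.P s (m s) j).toReal * (M.c s (m s) + V j - V s) =
        (M.P s (m s) j).toReal * (M.c s (m s) - V s) + (M.P s (m s) j).toReal * V j :=
      fun j => by ring
    simp_rw [h5]
    rw [Finset.sum_add_distrib, ← Finset.sum_mul, sum_toReal_eq_one]
    linarith

/-- For a chain started at `i` the first visit is at time `0`, so the total cost is almost surely `V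
i` plus the centred excess. -/
theorem IsPolicyValue.costToGo_eq (hssp : M.IsAcyclicSSP z) {m : M.Policy} {V : S → ℝ}
    (hV : M.IsPolicyValue z m V) : M.costToGo m = V := by
  classical
  obtain ⟨h, hh⟩ := hssp.exists_isHeight
  obtain ⟨K, hK⟩ : ∃ K, ∀ i, h i < K :=
    ⟨Finset.univ.sup h + 1, fun i => Nat.lt_succ_of_le (Finset.le_sup (Finset.mem_univ i))⟩
  ext i
  have hae : ∀ᵐ x ∂(M.trajLaw (PMF.pure i) m),
      ∑' k, M.c (x k) (m (x k)) = M.excess m V K i x + V i := by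
    filter_upwards [M.ae_isPath (PMF.pure i) m, M.ae_trajLaw_pure_zero m i] with x hx h0
    have hvis : Visits x i := ⟨0, h0⟩
    have hhit : hitTime x i = 0 := Nat.le_zero.1 (Nat.sInf_le h0)
    rw [hx.excess_eq hssp hh hK hV.absorbing, if_pos hvis]
    rw [sub_add_cancel]
    exact tsum_congr fun k => by rw [hhit, zero_add]
  unfold costToGo
  rw [integral_congr_ae hae, integral_add (integrable_excess _ m V K i) (integrable_const _),
    hV.integral_excess]
  simp

theorem isPolicyValue_costToGo (hssp : M.IsAcyclicSSP z) (m : M.Policy) :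
    M.IsPolicyValue z m (M.costToGo m) := by
  obtain ⟨V, hV⟩ := exists_isPolicyValue hssp m
  rw [hV.costToGo_eq hssp]
  exact hV

/-- A policy attaining the Bellman minima of a solution `V` has cost exactly `V`, and no policy does
better, so `V` is the minimal cost. -/
theorem isOptimalValue_optimalCost (hssp : M.IsAcyclicSSP z) :
    M.IsOptimalValue z M.optimalCost := by
  obtain ⟨V, hV⟩ := exists_isOptimalValue hssp
  choose m hm using hV.exists_eq
  have h1 : M.costToGo m = V := IsPolicyValue.costToGo_eq hssp ⟨hV.absorbing, hm⟩
  have h2 : M.optimalCost = V := by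
    ext i
    refine le_antisymm ?_ (le_ciInf fun m' => hV.le hssp (isPolicyValue_costToGo hssp m') i)
    exact (ciInf_le (Set.finite_range _).bddBelow m).trans_eq (by rw [h1])
  rw [h2]
  exact hV

end Excess

end FiniteMDP

/-! ### Counting visits -/

namespace FiniteMDP

section VisitCount

variable {S : Type u}

open Classical in
theorem visitCount_succ (x : ℕ → ℕ → S) (t : ℕ) (i : S) :
    visitCount x (t + 1) i = visitCount x t i + if Visits (x t) i then 1 else 0 := by
  unfold visitCount
  rw [Finset.range_add_one, Finset.filter_insert]
  split_ifs
  · rw [Finset.card_insert_of_notMem (by simp)]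
  · rw [add_zero]

open Classical in
/-- Summing a function of the number of earlier visits over the visiting times. -/
theorem sum_visits_visitCount (x : ℕ → ℕ → S) (i : S) (g : ℕ → ℝ) (N : ℕ) :
    ∑ t ∈ Finset.range N, (if Visits (x t) i then g (visitCount x t i) else 0) =
      ∑ k ∈ Finset.range (visitCount x N i), g k := by
  induction N with
  | zero => simp [visitCount]
  | succ N ih =>
    rw [Finset.sum_range_succ, ih, visitCount_succ]
    split_ifs
    · rw [Finset.sum_range_succ]
    · simp

theorem measurableSet_visits [MeasurableSpace S] [MeasurableSingletonClass S] (i : S) :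
    MeasurableSet {x : ℕ → S | Visits x i} := by
  have : {x : ℕ → S | Visits x i} = ⋃ k, (fun x => x k) ⁻¹' {i} := by
    ext x; simp [Visits]
  rw [this]
  exact MeasurableSet.iUnion fun k => measurable_pi_apply k (measurableSet_singleton i)

end VisitCount

-- Splitting over the finitely many policies reduces a random policy to fixed ones, each on an event
-- of the past.
open Classical in
theorem apply_eq_sum_indicator {S : Type u} {M : FiniteMDP.{u, v} S} {Ω : Type w}
    [Fintype M.Policy] (pol : ℕ → Ω → M.Policy) (X : ℕ → Ω → ℕ → S) (f : M.Policy → (ℕ → S) → ℝ) (t : ℕ) :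
    (fun ω => f (pol t ω) (X t ω)) =
      fun ω => ∑ m, {ω | pol t ω = m}.indicator (fun ω => f m (X t ω)) ω := by
  ext ω
  rw [Finset.sum_eq_single (pol t ω)]
  · simp
  · intro m _ hm
    rw [Set.indicator_of_notMem]
    exact fun h => hm h.symm
  · simp

/-! ### Conditional laws and noise along a run -/

section Run

variable {S : Type u} [Fintype S] [MeasurableSpace S] [MeasurableSingletonClass S]
  {M : FiniteMDP.{u, v} S} {p : PMF S} {Ω : Type w} {mΩ : MeasurableSpace Ω} {ℙ' : Measure Ω}
  {ℱ : Filtration ℕ mΩ} {γ : ℕ → Ω → S → ℝ} {J : ℕ → Ω → S → ℝ}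
  {pol : ℕ → Ω → M.Policy} {X : ℕ → Ω → ℕ → S}

namespace IsOPIRun

theorem measurable_traj (hrun : M.IsOPIRun p ℙ' ℱ γ J pol X) (t : ℕ) : Measurable (X t) :=
  (hrun.traj_measurable t).mono (ℱ.le _) le_rfl

theorem stronglyMeasurable_apply (hrun : M.IsOPIRun p ℙ' ℱ γ J pol X)
    {f : M.Policy → (ℕ → S) → ℝ} (hf : ∀ m, Measurable (f m)) (t : ℕ) :
    StronglyMeasurable[ℱ (t + 1)] fun ω => f (pol t ω) (X t ω) := by
  classical
  have := Fintype.ofFinite M.Policy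
  rw [apply_eq_sum_indicator]
  refine Finset.stronglyMeasurable_fun_sum _ fun m _ => ?_
  refine StronglyMeasurable.indicator ?_ (ℱ.mono t.le_succ _ (hrun.pol_measurable t m))
  exact ((hf m).comp (hrun.traj_measurable t)).stronglyMeasurable

theorem measurable_visitCount (hrun : M.IsOPIRun p ℙ' ℱ γ J pol X) (t : ℕ) (i : S) :
    Measurable[ℱ t] fun ω => visitCount (fun s => X s ω) t i := by
  classical
  induction t with
  | zero => simp only [visitCount, Finset.range_zero, Finset.filter_empty, Finset.card_empty]
            exact measurable_const
  | succ t ih =>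
    simp_rw [visitCount_succ]
    refine Measurable.add (ih.mono (ℱ.mono t.le_succ) le_rfl) ?_
    exact Measurable.ite (hrun.traj_measurable t (measurableSet_visits i)) measurable_const
      measurable_const

variable [IsProbabilityMeasure ℙ']

/-- On an event of the past on which the policy is `m`, the trajectory has the law of the chain
that follows `m`. -/
theorem map_restrict_eq (hrun : M.IsOPIRun p ℙ' ℱ γ J pol X) {t : ℕ} {m : M.Policy} {A : Set Ω}
    (hA : MeasurableSet[ℱ t] A) (hAm : ∀ ω ∈ A, pol t ω = m) :
    (ℙ'.restrict A).map (X t) = ℙ' A • M.trajLaw p m := by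
  have hA' : MeasurableSet A := ℱ.le t A hA
  ext B hB
  have hXB : MeasurableSet (X t ⁻¹' B) := hrun.measurable_traj t hB
  rw [Measure.map_apply (hrun.measurable_traj t) hB, Measure.restrict_apply hXB,
    Measure.smul_apply, smul_eq_mul]
  have h1 : ∫ ω in A, (ℙ'⟦X t ⁻¹' B | ℱ t⟧) ω ∂ℙ' =
      ∫ ω in A, (X t ⁻¹' B).indicator (fun _ => (1 : ℝ)) ω ∂ℙ' :=
    setIntegral_condExp (ℱ.le t) ((integrable_const 1).indicator hXB) hA
  have h2 : ∫ ω in A, (ℙ'⟦X t ⁻¹' B | ℱ t⟧) ω ∂ℙ' = ∫ _ in A, (M.trajLaw p m).real B ∂ℙ' := by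
    refine setIntegral_congr_ae hA' ?_
    filter_upwards [hrun.traj_law t B hB] with ω hω hωA
    rw [hω, hAm ω hωA]
  rw [h2, setIntegral_const, integral_indicator_const _ hXB, smul_eq_mul, smul_eq_mul, mul_one,
    measureReal_restrict_apply hXB] at h1
  simp only [Measure.real] at h1
  rw [← ENNReal.toReal_mul] at h1
  exact ((ENNReal.toReal_eq_toReal_iff' (ENNReal.mul_ne_top (measure_ne_top _ _)
    (measure_ne_top _ _)) (measure_ne_top _ _)).1 h1).symm

theorem ae_isPath (hrun : M.IsOPIRun p ℙ' ℱ γ J pol X) :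
    ∀ᵐ ω ∂ℙ', ∀ t, M.IsPath (pol t ω) (X t ω) := by
  rw [ae_all_iff]
  intro t
  have h1 : ∀ m, ∀ᵐ ω ∂ℙ', pol t ω = m → M.IsPath m (X t ω) := by
    intro m
    have hset := hrun.pol_measurable t m
    have h2 : ∀ᵐ x ∂((ℙ'.restrict {ω | pol t ω = m}).map (X t)), M.IsPath m x := by
      rw [hrun.map_restrict_eq hset fun ω hω => hω]
      exact Measure.ae_smul_measure (M.ae_isPath p m) _
    exact (ae_restrict_iff' (ℱ.le t _ hset)).1
      (ae_of_ae_map (hrun.measurable_traj t).aemeasurable h2)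
  filter_upwards [ae_all_iff.2 h1] with ω hω
  exact hω _ rfl

/-- A function of the policy and the trajectory that has mean zero for each policy is centred
given the past. -/
theorem condExp_apply_eq_zero (hrun : M.IsOPIRun p ℙ' ℱ γ J pol X)
    {f : M.Policy → (ℕ → S) → ℝ} (hf : ∀ m, Measurable (f m)) {C : ℝ}
    (hC : ∀ m x, |f m x| ≤ C) (hf0 : ∀ m, ∫ x, f m x ∂(M.trajLaw p m) = 0) (t : ℕ) :
    ℙ'[fun ω => f (pol t ω) (X t ω) | ℱ t] =ᵐ[ℙ'] 0 := by
  classical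
  have := Fintype.ofFinite M.Policy
  have hset : ∀ m, MeasurableSet {ω | pol t ω = m} := fun m =>
    ℱ.le t _ (hrun.pol_measurable t m)
  have hfi : ∀ m, Integrable (fun ω => f m (X t ω)) ℙ' := fun m =>
    Integrable.of_bound ((hf m).comp (hrun.measurable_traj t)).aestronglyMeasurable C
      (ae_of_all _ fun ω => hC m _)
  symm
  refine ae_eq_condExp_of_forall_setIntegral_eq (ℱ.le t) ?_ (fun _ _ _ => integrableOn_zero)
    (fun A hA _ => ?_) stronglyMeasurable_zero.aestronglyMeasurable
  · exact Integrable.of_bound ((hrun.stronglyMeasurable_apply hf t).mono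
      (ℱ.le _)).aestronglyMeasurable C (ae_of_all _ fun ω => hC _ _)
  · rw [apply_eq_sum_indicator, integral_finsetSum]
    · simp only [Pi.zero_apply, integral_zero]
      symm
      refine Finset.sum_eq_zero fun m _ => ?_
      rw [setIntegral_indicator (hset m)]
      have h1 := hrun.map_restrict_eq (m := m)
        (MeasurableSet.inter hA (hrun.pol_measurable t m)) (fun ω hω => hω.2)
      have h2 : ∫ ω in A ∩ {ω | pol t ω = m}, f m (X t ω) ∂ℙ' =
          ∫ x, f m x ∂((ℙ'.restrict (A ∩ {ω | pol t ω = m})).map (X t)) := by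
        rw [integral_map (hrun.measurable_traj t).aemeasurable (hf m).aestronglyMeasurable]
      rw [h2, h1, integral_smul_measure, hf0, smul_zero]
    · exact fun m _ => ((hfi m).indicator (hset m)).integrableOn

/-- Weighted sums of centred functions of the policy and the trajectory converge almost surely,
provided the squares of their terms have a bounded sum. -/
theorem ae_exists_tendsto_sum (hrun : M.IsOPIRun p ℙ' ℱ γ J pol X)
    {f : M.Policy → (ℕ → S) → ℝ} (hf : ∀ m, Measurable (f m)) {C : ℝ}
    (hC : ∀ m x, |f m x| ≤ C) (hf0 : ∀ m, ∫ x, f m x ∂(M.trajLaw p m) = 0)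
    {g : ℕ → Ω → ℝ} (hg : ∀ t, StronglyMeasurable[ℱ t] (g t)) {D : ℝ}
    (hD : ∀ t ω, |g t ω| ≤ D) {B : ℝ}
    (hsq : ∀ N ω, ∑ t ∈ Finset.range N, (g t ω * f (pol t ω) (X t ω)) ^ 2 ≤ B) :
    ∀ᵐ ω ∂ℙ', ∃ W, Tendsto (fun N => ∑ t ∈ Finset.range N, g t ω * f (pol t ω) (X t ω)) atTop
      (𝓝 W) := by
  have hfm := fun t => hrun.stronglyMeasurable_apply hf t
  have hm : ∀ t, StronglyMeasurable[ℱ (t + 1)] fun ω => g t ω * f (pol t ω) (X t ω) :=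
    fun t => ((hg t).mono (ℱ.mono t.le_succ)).mul (hfm t)
  have hb : ∀ t ω, |g t ω * f (pol t ω) (X t ω)| ≤ D * C := by
    intro t ω
    rw [abs_mul]
    exact mul_le_mul (hD t ω) (hC _ _) (abs_nonneg _) ((abs_nonneg _).trans (hD t ω))
  refine ae_exists_tendsto_sum_of_martingale_difference
    (ξ := fun t ω => g t ω * f (pol t ω) (X t ω)) hm (fun t => ⟨_, hb t⟩) (fun t => ?_) hsq
  have h1 : ℙ'[g t * (fun ω => f (pol t ω) (X t ω)) | ℱ t] =ᵐ[ℙ']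
      g t * ℙ'[fun ω => f (pol t ω) (X t ω) | ℱ t] :=
    condExp_mul_of_stronglyMeasurable_left (hg t)
      (Integrable.of_bound ((hm t).mono (ℱ.le _)).aestronglyMeasurable _ (ae_of_all _ (hb t)))
      (Integrable.of_bound ((hfm t).mono (ℱ.le _)).aestronglyMeasurable C
        (ae_of_all _ fun ω => hC _ _))
  filter_upwards [h1, hrun.condExp_apply_eq_zero hf hC hf0 t] with ω h1 h2
  exact h1.trans (by rw [Pi.mul_apply, h2]; simp)

open Classical in
/-- Almost surely, every state is visited often enough for the step sizes at the visiting times to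
have a divergent sum. -/
theorem ae_tendsto_sum_visits (hrun : M.IsOPIRun p ℙ' ℱ γ J pol X)
    (hreach : M.PositiveReachability p) {b : ℕ → ℝ} (hb : ∀ t, 0 ≤ b t)
    (hbsum : Tendsto (fun N => ∑ t ∈ Finset.range N, b t) atTop atTop)
    (hbsq : Summable fun t => b t ^ 2) (i : S) :
    ∀ᵐ ω ∂ℙ', Tendsto (fun N => ∑ t ∈ Finset.range N, if Visits (X t ω) i then b t else 0)
      atTop atTop := by
  let q : M.Policy → ℝ := fun m => (M.reachProb p m i).toReal
  have hq : ∀ m, 0 < q m ∧ q m ≤ 1 := by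
    intro m
    refine ⟨ENNReal.toReal_pos (hreach m i).ne' (measure_ne_top _ _), ?_⟩
    exact ENNReal.toReal_mono ENNReal.one_ne_top prob_le_one
  -- As there are finitely many policies, `q m₀` is a positive lower bound for all the visiting
  -- probabilities.
  obtain ⟨m₀, hm₀⟩ := Finite.exists_min q
  let f : M.Policy → (ℕ → S) → ℝ := fun m x => (if Visits x i then 1 else 0) - q m
  have hind : (fun x : ℕ → S => if Visits x i then (1 : ℝ) else 0) =
      {x : ℕ → S | Visits x i}.indicator fun _ => 1 := by
    ext x; simp [Set.indicator_apply]
  have hf : ∀ m, Measurable (f m) := fun m =>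
    (Measurable.ite (measurableSet_visits i) measurable_const measurable_const).sub_const _
  have hC : ∀ m x, |f m x| ≤ 1 := by
    intro m x
    have := hq m
    simp only [f]
    rw [abs_le]
    split_ifs <;> constructor <;> linarith
  have hf0 : ∀ m, ∫ x, f m x ∂(M.trajLaw p m) = 0 := by
    intro m
    have hi : Integrable (fun x : ℕ → S => if Visits x i then (1 : ℝ) else 0)
        (M.trajLaw p m) := by
      rw [hind]
      exact (integrable_const 1).indicator (measurableSet_visits i)
    simp only [f]
    rw [integral_sub hi (integrable_const _), hind,
      integral_indicator_const _ (measurableSet_visits i)]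
    simp [q, reachProb, Measure.real, Visits]
  obtain ⟨D, hD⟩ : ∃ D, ∀ t, b t ≤ D := by
    refine ⟨1 + ∑' t, b t ^ 2, fun t => ?_⟩
    have := hbsq.le_tsum t fun _ _ => sq_nonneg _
    nlinarith [sq_nonneg (b t - 1)]
  have hsq : ∀ N ω, ∑ t ∈ Finset.range N, (b t * f (pol t ω) (X t ω)) ^ 2 ≤ ∑' t, b t ^ 2 := by
    intro N ω
    refine (Finset.sum_le_sum fun t _ => ?_).trans
      (hbsq.sum_le_tsum (Finset.range N) fun _ _ => sq_nonneg _)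
    rw [mul_pow]
    refine mul_le_of_le_one_right (sq_nonneg _) ?_
    rw [← sq_abs]
    exact pow_le_one₀ (abs_nonneg _) (hC _ _)
  filter_upwards [hrun.ae_exists_tendsto_sum hf hC hf0 (g := fun t _ => b t)
    (fun _ => stronglyMeasurable_const)
    (fun t _ => by rw [abs_of_nonneg (hb t)]; exact hD t) hsq] with ω hω
  obtain ⟨W, hW⟩ := hω
  -- The visit indicator is `q (pol t ω)` plus centred noise, so the sum dominates `q m₀ * ∑ b t`
  -- plus a convergent series.
  have h1 := (hbsum.const_mul_atTop (hq m₀).1).atTop_add hW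
  refine tendsto_atTop_mono (fun N => ?_) h1
  rw [Finset.mul_sum, ← Finset.sum_add_distrib]
  refine Finset.sum_le_sum fun t _ => ?_
  have h2 := mul_le_mul_of_nonneg_right (hm₀ (pol t ω)) (hb t)
  simp only [f]
  split_ifs <;> linarith

end IsOPIRun

/-! ### Both step-size rules are admissible -/

open Classical in
/-- Step sizes for the updates of state `i` that are small in the square-summable sense along the
visits to `i`, and large in the sense that their sum along these visits diverges. -/
structure AdmissibleSteps (ℙ' : Measure Ω) (ℱ : Filtration ℕ mΩ) (γ : ℕ → Ω → S → ℝ)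
    (X : ℕ → Ω → ℕ → S) (i : S) : Prop where
  nonneg : ∀ t ω, 0 ≤ γ t ω i
  measurable : ∀ t, StronglyMeasurable[ℱ t] fun ω => γ t ω i
  bounded : ∃ D, ∀ t ω, γ t ω i ≤ D
  sum_sq : ∃ B, ∀ N ω,
    ∑ t ∈ Finset.range N, (if Visits (X t ω) i then γ t ω i ^ 2 else 0) ≤ B
  sum_atTop : ∀ᵐ ω ∂ℙ', Tendsto
    (fun N => ∑ t ∈ Finset.range N, if Visits (X t ω) i then γ t ω i else 0) atTop atTop

namespace IsOPIRun

variable [IsProbabilityMeasure ℙ']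

theorem admissibleSteps_of_deterministic (hrun : M.IsOPIRun p ℙ' ℱ γ J pol X)
    (hreach : M.PositiveReachability p) {β : ℕ → ℝ} (hβ : ∀ t, 0 ≤ β t)
    (hβsum : Tendsto (fun N => ∑ t ∈ Finset.range N, β t) atTop atTop)
    (hβsq : Summable fun t => β t ^ 2) (hγ : ∀ t ω i, γ t ω i = β t) (i : S) :
    AdmissibleSteps ℙ' ℱ γ X i where
  nonneg t ω := by rw [hγ]; exact hβ t
  measurable t := by simp_rw [hγ]; exact stronglyMeasurable_const
  bounded := by
    refine ⟨1 + ∑' t, β t ^ 2, fun t ω => ?_⟩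
    rw [hγ]
    have := hβsq.le_tsum t fun _ _ => sq_nonneg _
    nlinarith [sq_nonneg (β t - 1)]
  sum_sq := by
    refine ⟨∑' t, β t ^ 2, fun N ω => (Finset.sum_le_sum fun t _ => ?_).trans
      (hβsq.sum_le_tsum (Finset.range N) fun _ _ => sq_nonneg _)⟩
    rw [hγ]
    split_ifs
    · exact le_rfl
    · exact sq_nonneg _
  sum_atTop := by
    simp_rw [hγ]
    exact hrun.ae_tendsto_sum_visits hreach hβ hβsum hβsq i

theorem ae_tendsto_visitCount (hrun : M.IsOPIRun p ℙ' ℱ γ J pol X)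
    (hreach : M.PositiveReachability p) (i : S) :
    ∀ᵐ ω ∂ℙ', Tendsto (fun t => visitCount (fun s => X s ω) t i) atTop atTop := by
  classical
  -- The auxiliary weights `1 / (t + 1)` are at most `1`, so a divergent weighted sum over the
  -- visits forces infinitely many visits.
  have hsq : Summable fun t : ℕ => (1 / ((t : ℝ) + 1)) ^ 2 := by
    have h1 := (summable_nat_add_iff 1).2
      (Real.summable_one_div_nat_pow.2 (one_lt_two : 1 < 2))
    refine h1.congr fun t => ?_
    push_cast
    rw [div_pow, one_pow]
  filter_upwards [hrun.ae_tendsto_sum_visits hreach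
    (b := fun t => 1 / ((t : ℝ) + 1)) (fun t => by positivity)
    Real.tendsto_sum_range_one_div_nat_succ_atTop hsq i] with ω hω
  have hcast : Tendsto (fun t => (visitCount (fun s => X s ω) t i : ℝ)) atTop atTop := by
    refine tendsto_atTop_mono (fun N => ?_) hω
    have h2 := sum_visits_visitCount (fun s => X s ω) i (fun _ => 1) N
    simp only [Finset.sum_const, Finset.card_range, nsmul_eq_mul, mul_one] at h2
    rw [← h2]
    refine Finset.sum_le_sum fun t _ => ?_
    split_ifs
    · rw [div_le_one (by positivity)]
      linarith [(Nat.cast_nonneg t : (0 : ℝ) ≤ t)]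
    · exact le_rfl
  exact tendsto_natCast_atTop_iff.1 hcast

theorem admissibleSteps_of_visitCount (hrun : M.IsOPIRun p ℙ' ℱ γ J pol X)
    (hreach : M.PositiveReachability p) {β : ℕ → ℝ} (hβ : ∀ t, 0 ≤ β t)
    (hβsum : Tendsto (fun N => ∑ t ∈ Finset.range N, β t) atTop atTop)
    (hβsq : Summable fun t => β t ^ 2)
    (hγ : ∀ t ω i, γ t ω i = β (visitCount (fun s => X s ω) t i)) (i : S) :
    AdmissibleSteps ℙ' ℱ γ X i where
  nonneg t ω := by rw [hγ]; exact hβ _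
  measurable t := by
    simp_rw [hγ]
    exact ((Measurable.of_discrete (f := β)).comp
      (hrun.measurable_visitCount t i)).stronglyMeasurable
  bounded := by
    refine ⟨1 + ∑' t, β t ^ 2, fun t ω => ?_⟩
    rw [hγ]
    generalize visitCount _ _ _ = k
    have := hβsq.le_tsum k fun _ _ => sq_nonneg _
    nlinarith [sq_nonneg (β k - 1)]
  sum_sq := by
    refine ⟨∑' t, β t ^ 2, fun N ω => ?_⟩
    simp_rw [hγ]
    rw [sum_visits_visitCount (fun s => X s ω) i (fun k => β k ^ 2)]
    exact hβsq.sum_le_tsum _ fun _ _ => sq_nonneg _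
  sum_atTop := by
    filter_upwards [hrun.ae_tendsto_visitCount hreach i] with ω hω
    simp_rw [hγ]
    simp_rw [sum_visits_visitCount (fun s => X s ω) i β]
    exact hβsum.comp hω

/-! ### Convergence of the iteration -/

/-- The values of state `i` follow the costs-to-go of the policies at `i`. -/
theorem ae_tendsto_of_tendsto_costToGo {z : S} (hssp : M.IsAcyclicSSP z)
    (hrun : M.IsOPIRun p ℙ' ℱ γ J pol X) {i : S} (hγ : AdmissibleSteps ℙ' ℱ γ X i) :
    ∀ᵐ ω ∂ℙ', ∀ l, Tendsto (fun t => M.costToGo (pol t ω) i) atTop (𝓝 l) →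
      Tendsto (fun t => J t ω i) atTop (𝓝 l) := by
  classical
  obtain ⟨h, hh⟩ := hssp.exists_isHeight
  obtain ⟨K, hK⟩ : ∃ K, ∀ i, h i < K :=
    ⟨Finset.univ.sup h + 1, fun i => Nat.lt_succ_of_le (Finset.le_sup (Finset.mem_univ i))⟩
  have hval := isPolicyValue_costToGo hssp
  let f : M.Policy → (ℕ → S) → ℝ := fun m => M.excess m (M.costToGo m) K i
  have hCm : ∀ m, ∃ C, 0 ≤ C ∧ ∀ x, |f m x| ≤ if Visits x i then C else 0 := by
    intro m
    obtain ⟨C, hC, hb⟩ := M.exists_abs_excess_le m (M.costToGo m) K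
    exact ⟨C, hC, hb i⟩
  choose C' hC'0 hC' using hCm
  obtain ⟨m₁, hm₁⟩ := Finite.exists_max C'
  set C := C' m₁
  have hC0 : 0 ≤ C := hC'0 m₁
  have hCv : ∀ m x, |f m x| ≤ if Visits x i then C else 0 := by
    intro m x
    refine (hC' m x).trans ?_
    split_ifs
    · exact hm₁ m
    · exact le_rfl
  have hC : ∀ m x, |f m x| ≤ C := by
    intro m x
    refine (hCv m x).trans ?_
    split_ifs
    · exact le_rfl
    · exact hC0
  obtain ⟨D, hD⟩ := hγ.bounded
  obtain ⟨B, hB⟩ := hγ.sum_sq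
  have hsq : ∀ N ω, ∑ t ∈ Finset.range N, (γ t ω i * f (pol t ω) (X t ω)) ^ 2 ≤ C ^ 2 * B := by
    intro N ω
    refine le_trans ?_ (mul_le_mul_of_nonneg_left (hB N ω) (sq_nonneg C))
    rw [Finset.mul_sum]
    refine Finset.sum_le_sum fun t _ => ?_
    have h1 := hCv (pol t ω) (X t ω)
    rw [mul_pow, ← sq_abs (f _ _)]
    split_ifs at h1 ⊢
    · rw [mul_comm]
      exact mul_le_mul_of_nonneg_right (pow_le_pow_left₀ (abs_nonneg _) h1 2) (sq_nonneg _)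
    · rw [le_antisymm h1 (abs_nonneg _)]
      simp
  filter_upwards [hrun.ae_isPath, hγ.sum_atTop,
    hrun.ae_exists_tendsto_sum (fun m => measurable_excess m (M.costToGo m) K i) hC
      (fun m => (hval m).integral_excess p K i) hγ.measurable
      (fun t ω => by rw [abs_of_nonneg (hγ.nonneg t ω)]; exact hD t ω) hsq]
    with ω hpath hatTop hnoise l hl
  let a : ℕ → ℝ := fun t => if Visits (X t ω) i then γ t ω i else 0
  have ha : ∀ t, 0 ≤ a t := by
    intro t
    simp only [a]
    split_ifs
    · exact hγ.nonneg t ω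
    · exact le_rfl
  have hasq : Summable fun t => a t ^ 2 := by
    refine summable_of_sum_range_le (c := B) (fun t => sq_nonneg _) fun N => ?_
    refine (Finset.sum_congr rfl fun t _ => ?_).trans_le (hB N ω)
    simp only [a]
    split_ifs <;> simp
  have ha0 : Tendsto a atTop (𝓝 0) := by
    have h1 := hasq.tendsto_atTop_zero.sqrt
    rw [Real.sqrt_zero] at h1
    exact h1.congr fun t => Real.sqrt_sq (ha t)
  -- The step `a t` depends on the current trajectory, but `f` vanishes off the visits to `i`; the
  -- noise can thus carry the weight `γ t ω i`, which is known before sampling.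
  refine tendsto_of_stochastic_approximation (a := a)
    (w := fun t => γ t ω i * f (pol t ω) (X t ω)) ha ha0 hatTop hnoise hl fun t => ?_
  have h2 : f (pol t ω) (X t ω) = _ :=
    (hpath t).excess_eq hssp hh hK (hval (pol t ω)).absorbing i
  rw [hrun.step, h2]
  simp only [update, a]
  split_ifs <;> ring

theorem ae_tendsto_optimalCost {z : S} (hssp : M.IsAcyclicSSP z)
    (hrun : M.IsOPIRun p ℙ' ℱ γ J pol X) (hγ : ∀ i, AdmissibleSteps ℙ' ℱ γ X i) :
    ∀ᵐ ω ∂ℙ', Tendsto (fun t => J t ω) atTop (𝓝 M.optimalCost) := by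
  obtain ⟨h, hh⟩ := hssp.exists_isHeight
  have hopt := isOptimalValue_optimalCost hssp
  have hval := isPolicyValue_costToGo hssp
  filter_upwards [ae_all_iff.2 fun i => hrun.ae_tendsto_of_tendsto_costToGo hssp (hγ i)]
    with ω hω
  -- Only the policy costs need the induction: by `hω`, their convergence at the lower states
  -- carries over to `J t ω`.
  have key : ∀ i, Tendsto (fun t => M.costToGo (pol t ω) i) atTop (𝓝 (M.optimalCost i)) := by
    intro i
    induction hn : h i using Nat.strong_induction_on generalizing i with
    | _ n ih =>
      by_cases hi : i = z
      · subst hi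
        simp_rw [(hval _).absorbing, hopt.absorbing]
        exact tendsto_const_nhds
      · rw [tendsto_iff_norm_sub_tendsto_zero]
        have hsum : Tendsto (fun t =>
            (∑ j with h j < h i, |M.costToGo (pol t ω) j - M.optimalCost j|) +
              2 * ∑ j with h j < h i, |J t ω j - M.optimalCost j|) atTop (𝓝 0) := by
          have hlim : ∀ j ∈ Finset.univ.filter (fun j => h j < h i),
              Tendsto (fun t => M.costToGo (pol t ω) j) atTop (𝓝 (M.optimalCost j)) :=
            fun j hj => ih (h j) (hn ▸ (Finset.mem_filter.1 hj).2) j rfl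
          have h1 := tendsto_finsetSum _ fun j hj =>
            tendsto_iff_norm_sub_tendsto_zero.1 (hlim j hj)
          have h2 := tendsto_finsetSum _ fun j hj =>
            tendsto_iff_norm_sub_tendsto_zero.1 (hω j _ (hlim j hj))
          simpa using h1.add (h2.const_mul 2)
        exact squeeze_zero (fun t => norm_nonneg _) (fun t =>
          abs_value_sub_le_of_isGreedy hssp hh hopt (hval _) (hrun.greedy t ω) hi) hsum
  exact tendsto_pi_nhds.2 fun i => hω i _ (key i)

end IsOPIRun

end Run

end FiniteMDP

theorem mainTheorem2 {n : ℕ} (M : FiniteMDP.{0, v} (Fin (n + 1))) (p : PMF (Fin (n + 1)))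
    (hreach : M.PositiveReachability p)
    (hcommon : M.CommonTransitions)
    (hssp : M.IsAcyclicSSP 0)
    (β : ℕ → ℝ) (hβ : ∀ t, 0 ≤ β t)
    (hβsum : Tendsto (fun N => ∑ t ∈ Finset.range N, β t) atTop atTop)
    (hβsq : Summable fun t => β t ^ 2)
    {Ω : Type w} {mΩ : MeasurableSpace Ω} (ℙ' : Measure Ω) [IsProbabilityMeasure ℙ']
    (ℱ : Filtration ℕ mΩ)
    (γ : ℕ → Ω → Fin (n + 1) → ℝ) (J : ℕ → Ω → Fin (n + 1) → ℝ)
    (pol : ℕ → Ω → M.Policy) (X : ℕ → Ω → ℕ → Fin (n + 1))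
    (hrun : M.IsOPIRun p ℙ' ℱ γ J pol X)
    (hγ : (∀ t ω i, γ t ω i = β t) ∨
      ((∃ T, AntitoneOn β (Set.Ioi T)) ∧
        ∀ t ω i, γ t ω i = β (FiniteMDP.visitCount (fun s => X s ω) t i))) :
    ∀ᵐ ω ∂ℙ', Tendsto (fun t => J t ω) atTop (𝓝 M.optimalCost) := by
  refine hrun.ae_tendsto_optimalCost hssp fun i => ?_
  rcases hγ with hγ | ⟨-, hγ⟩
  · exact hrun.admissibleSteps_of_deterministic hreach hβ hβsum hβsq hγ i
  · exact hrun.admissibleSteps_of_visitCount hreach hβ hβsum hβsq hγ i
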